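/- Let $\mathbb{T}$ be the unit circle with normalized arc length $\frac{d\xi}{2\pi}$, let $L^2=L^2(\mathbb{T})$, let $H^2\subset L^2$ be the Hardy space of functions whose Fourier coefficients of negative order vanish, and let $H^\infty=H^2\cap L^\infty(\mathbb{T})$. For $\varphi\in L^2$ the Toeplitz operator $T_\varphi$ is defined on $H^\infty$ by $T_\varphi g=P_{H^2}(\varphi g)$, where $P_{H^2}$ is the orthogonal projection of $L^2$ onto $H^2$. For $\lambda$ in the open unit disc $\mathbb{D}$ put $b_\lambda(\xi)=\frac{\xi-\lambda}{1-\bar\lambda\xi}$, and for $n\in\mathbb{N}$ let $K_{b_\lambda^n}=H^2\cap(b_\lambda^nH^2)^\perp$ be the model space associated with $b_\lambda^n$. It is finite dimensional and contained in $H^\infty$. Let $T_{\varphi,K_{b_\lambda^n}}\colon K_{b_\lambda^n}\to K_{b_\lambda^n}$, $g\mapsto P_{K_{b_\lambda^n}}T_\varphi g$, be the compression of $T_\varphi$ to it. Denote by $\lambda_k(A)$ the eigenvalues (with algebraic multiplicity) and by $\sigma_k(A)$ the singular values of an operator $A$ on a finite dimensional space. Theorem. Let $\lambda\in\mathbb{D}$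 and let $f\in L^2$ be real valued. Then $T_f$ is distributed as $f\circ b_{-\lambda}$ in the sense of the eigenvalues relative to the sequence of model spaces $(K_{b_\lambda^n})_{n\in\mathbb{N}}$, that is, for every continuous function $G:\mathbb{C}\to\mathbb{C}$ with compact support, $$\lim_{n\to\infty}\frac{1}{\dim K_{b_\lambda^n}}\sum_{k=1}^{\dim K_{b_\lambda^n}}G\bigl(\lambda_k(T_{f,K_{b_\lambda^n}})\bigr)=\frac1{2\pi}\int_{\mathbb{T}}G\bigl((f\circ b_{-\lambda})(\xi)\bigr)\,d\xi ,$$ and $T_f$ is distributed as $|f\circ b_{-\lambda}|$ in the sense of the singular values relative to the same sequence, that is, for every continuous function $G:\mathbb{R}\to\mathbb{C}$ with compact support, $$\lim_{n\to\infty}\frac{1}{\dim K_{b_\lambda^n}}\sum_{k=1}^{\dim K_{b_\lambda^n}}G\bigl(\sigma_k(T_{f,K_{b_\lambda^n}})\bigr)=\frac1{2\pi}\int_{\mathbb{T}}G\bigl(|(f\circ b_{-\lambda})(\xi)|\bigr)\,d\xi .$$ -/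

import Mathlib

open MeasureTheory Filter Topology Complex.UnitDisc
open scoped ENNReal

noncomputable section

namespace ModelSpaces

/-- The unit circle carries its Borel sigma-algebra. -/
instance : MeasurableSpace Circle := borel Circle

instance : BorelSpace Circle := ⟨rfl⟩

/-- Normalized arc length `dξ / 2π` on the unit circle: the image of the normalized Haar measure
of `ℝ / 2πℤ` under `t ↦ exp (i t)`. -/
def circleMeasure : Measure Circle :=
  (@AddCircle.haarAddCircle (2 * Real.pi) ⟨Real.two_pi_pos⟩).map
    (AddCircle.toCircle : AddCircle (2 * Real.pi) → Circle)

instance : IsProbabilityMeasure circleMeasure :=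
  Measure.isProbabilityMeasure_map AddCircle.continuous_toCircle.measurable.aemeasurable

/-- The Hilbert space `L²` of the unit circle. -/
abbrev L2 : Type := Lp ℂ 2 circleMeasure

/-- The `n`-th Fourier coefficient of a function on the circle. -/
def circleCoeff (f : Circle → ℂ) (n : ℤ) : ℂ :=
  ∫ ξ, (ξ : ℂ) ^ (-n) * f ξ ∂circleMeasure

/-- The monomial `ξ ↦ ξ ^ n` as a continuous function on the circle. -/
def monomial (n : ℤ) : C(Circle, ℂ) :=
  ⟨fun ξ => ((ξ ^ n : Circle) : ℂ), continuous_subtype_val.comp (continuous_zpow n)⟩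

theorem inner_monomial (n : ℤ) (f : L2) :
    inner ℂ ((monomial n).toLp 2 circleMeasure ℂ) f = circleCoeff f n := by
  rw [L2.inner_def, circleCoeff]
  refine integral_congr_ae ?_
  filter_upwards [ContinuousMap.coeFn_toLp (p := 2) (𝕜 := ℂ) circleMeasure (monomial n)] with ξ hξ
  rw [hξ]
  simp [monomial, mul_comm, ← Circle.coe_inv_eq_conj]

/-- The Hardy space `H²`: the elements of `L²` whose Fourier coefficients of negative order
vanish. -/
def hardy : Submodule ℂ L2 where
  carrier := {f | ∀ n : ℤ, n < 0 → circleCoeff f n = 0}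
  zero_mem' := by
    intro n _
    rw [← inner_monomial, inner_zero_right]
  add_mem' := by
    intro f g hf hg n hn
    rw [← inner_monomial, inner_add_right, inner_monomial, inner_monomial, hf n hn, hg n hn,
      add_zero]
  smul_mem' := by
    intro c f hf n hn
    rw [← inner_monomial, inner_smul_right, inner_monomial, hf n hn, mul_zero]

theorem isClosed_hardy : IsClosed (hardy : Set L2) := by
  have h : (hardy : Set L2) = ⋂ n : ℤ, ⋂ _ : n < 0,
      {f : L2 | inner ℂ ((monomial n).toLp 2 circleMeasure ℂ) f = 0} := by
    ext f
    simp [hardy, inner_monomial]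
  rw [h]
  exact isClosed_iInter fun n => isClosed_iInter fun _ =>
    isClosed_eq (continuous_const.inner continuous_id) continuous_const

instance : CompleteSpace hardy := isClosed_hardy.completeSpace_coe

/-- `H^∞`, the space of essentially bounded elements of `H²`. -/
def hardyInf : Submodule ℂ L2 where
  carrier := {f | f ∈ hardy ∧ MemLp f ∞ circleMeasure}
  zero_mem' := ⟨hardy.zero_mem, MemLp.zero.ae_eq (Lp.coeFn_zero ℂ 2 circleMeasure).symm⟩
  add_mem' := fun {f g} hf hg =>
    ⟨hardy.add_mem hf.1 hg.1, (hf.2.add hg.2).ae_eq (Lp.coeFn_add f g).symm⟩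
  smul_mem' := fun c f hf =>
    ⟨hardy.smul_mem c hf.1, (hf.2.const_smul c).ae_eq (Lp.coeFn_smul c f).symm⟩

theorem memLp_mul (φ : L2) (g : hardyInf) :
    MemLp (fun ξ => φ ξ * (g : L2) ξ) 2 circleMeasure :=
  MemLp.mul (p := 2) (q := ∞) (r := 2) g.2.2 (Lp.memLp φ)

/-- The Toeplitz operator `T_φ` with symbol `φ ∈ L²`, defined on `H^∞` with values in `H²`:
`T_φ g` is the orthogonal projection of `φ g ∈ L²` onto `H²`. -/
def toeplitz (φ : L2) : hardyInf →ₗ[ℂ] hardy :=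
  hardy.orthogonalProjectionOnto.toLinearMap ∘ₗ
    { toFun := fun g => (memLp_mul φ g).toLp _
      map_add' := by
        intro g h
        rw [← MemLp.toLp_add]
        refine MemLp.toLp_congr _ _ ?_
        filter_upwards [Lp.coeFn_add (g : L2) (h : L2)] with ξ hξ
        simp only [Submodule.coe_add, hξ, Pi.add_apply, mul_add]
      map_smul' := by
        intro c g
        rw [RingHom.id_apply, ← MemLp.toLp_const_smul]
        refine MemLp.toLp_congr _ _ ?_
        filter_upwards [Lp.coeFn_smul c (g : L2)] with ξ hξ
        simp only [Submodule.coe_smul, hξ, Pi.smul_apply, smul_eq_mul]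
        ring }

/-- The space `θ H²` of the products `θ h` with `h ∈ H²`, for a unimodular function `θ` on the
circle. -/
def mulHardy (θ : Circle → Circle) : Submodule ℂ L2 where
  carrier := {f | ∃ h ∈ hardy, ∀ᵐ ξ ∂circleMeasure, f ξ = (θ ξ : ℂ) * h ξ}
  zero_mem' := ⟨0, hardy.zero_mem, by
    filter_upwards with ξ
    simp⟩
  add_mem' := by
    rintro f g ⟨h, hh, hf⟩ ⟨k, hk, hg⟩
    refine ⟨h + k, hardy.add_mem hh hk, ?_⟩
    filter_upwards [hf, hg, Lp.coeFn_add f g, Lp.coeFn_add h k] with ξ h1 h2 h3 h4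
    rw [h3, h4, Pi.add_apply, Pi.add_apply, h1, h2, mul_add]
  smul_mem' := by
    rintro c f ⟨h, hh, hf⟩
    refine ⟨c • h, hardy.smul_mem c hh, ?_⟩
    filter_upwards [hf, Lp.coeFn_smul c f, Lp.coeFn_smul c h] with ξ h1 h2 h3
    rw [h2, h3, Pi.smul_apply, Pi.smul_apply, h1, smul_eq_mul, smul_eq_mul]
    ring

/-- The model space `K_θ = H² ⊖ θ H²`. -/
def modelSpace (θ : Circle → Circle) : Submodule ℂ L2 :=
  hardy ⊓ (mulHardy θ)ᗮ

theorem isClosed_modelSpace (θ : Circle → Circle) : IsClosed (modelSpace θ : Set L2) :=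
  isClosed_hardy.inter (mulHardy θ).isClosed_orthogonal

instance (θ : Circle → Circle) : CompleteSpace (modelSpace θ) :=
  (isClosed_modelSpace θ).completeSpace_coe

/-- The compression `T_{φ, K_θ}` of the Toeplitz operator `T_φ` to the model space `K_θ`, that is
`g ↦ P_{K_θ} (T_φ g)` on `K_θ`, where `K_θ` is contained in the domain `H^∞` of `T_φ`. -/
def compression (φ : L2) (θ : Circle → Circle) (hθ : modelSpace θ ≤ hardyInf) :
    modelSpace θ →ₗ[ℂ] modelSpace θ :=
  (modelSpace θ).orthogonalProjectionOnto.toLinearMap ∘ₗ hardy.subtype ∘ₗ toeplitz φ ∘ₗ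
    Submodule.inclusion hθ

/-- `T_φ` is distributed as `g` in the sense of the eigenvalues relative to the model spaces
`K_{B^n}`: these are finite dimensional and contained in `H^∞`, so that the compressions of `T_φ`
are defined, and the means of the values of `G` at the eigenvalues of these compressions, counted
with algebraic multiplicity, converge to the mean of `G ∘ g`, for all continuous `G` with compact
support. -/
def IsDistributedEigenvalues (φ : L2) (g : Circle → ℂ) (B : Circle → Circle) : Prop :=
  AEMeasurable g circleMeasure ∧
  ∃ (_ : ∀ n : ℕ, FiniteDimensional ℂ (modelSpace (B ^ n)))
    (hB : ∀ n : ℕ, modelSpace (B ^ n) ≤ hardyInf),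
    ∀ G : ℂ → ℂ, Continuous G → HasCompactSupport G →
      Tendsto
        (fun n : ℕ => ((Module.finrank ℂ (modelSpace (B ^ n)) : ℂ))⁻¹ *
          ((compression φ (B ^ n) (hB n)).charpoly.roots.map G).sum)
        atTop (𝓝 (∫ ξ, G (g ξ) ∂circleMeasure))

/-- `T_φ` is distributed as `g` in the sense of the singular values relative to the model spaces
`K_{B^n}`: the same with the singular values of the compressions, as many as the dimension. -/
def IsDistributedSingularValues (φ : L2) (g : Circle → ℝ) (B : Circle → Circle) : Prop :=
  AEMeasurable g circleMeasure ∧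
  ∃ (_ : ∀ n : ℕ, FiniteDimensional ℂ (modelSpace (B ^ n)))
    (hB : ∀ n : ℕ, modelSpace (B ^ n) ≤ hardyInf),
    ∀ G : ℝ → ℂ, Continuous G → HasCompactSupport G →
      Tendsto
        (fun n : ℕ => ((Module.finrank ℂ (modelSpace (B ^ n)) : ℂ))⁻¹ *
          ∑ k ∈ Finset.range (Module.finrank ℂ (modelSpace (B ^ n))),
            G ((compression φ (B ^ n) (hB n)).singularValues k))
        atTop (𝓝 (∫ ξ, G (g ξ) ∂circleMeasure))

theorem norm_blaschke (a : 𝔻) (ξ : Circle) :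
    ‖((ξ : ℂ) - a) / (1 - (starRingEnd ℂ) (a : ℂ) * ξ)‖ = 1 := by
  have h : (1 : ℂ) - (starRingEnd ℂ) (a : ℂ) * ξ = ξ * (starRingEnd ℂ) ((ξ : ℂ) - a) := by
    rw [map_sub, mul_sub, Complex.mul_conj, Circle.normSq_coe]
    push_cast
    ring
  have h0 : (ξ : ℂ) - a ≠ 0 := by
    intro h1
    apply a.norm_ne_one
    rw [← sub_eq_zero.mp h1, Circle.norm_coe]
  rw [h, norm_div, norm_mul, Circle.norm_coe, one_mul, RCLike.norm_conj,
    div_self (norm_ne_zero_iff.mpr h0)]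

/-- The Blaschke factor `b_a(ξ) = (ξ - a) / (1 - conj a * ξ)`, for `a` in the open unit disc, as a
map of the unit circle to itself. -/
def blaschke (a : 𝔻) (ξ : Circle) : Circle :=
  ⟨((ξ : ℂ) - a) / (1 - (starRingEnd ℂ) (a : ℂ) * ξ),
    mem_sphere_zero_iff_norm.mpr (norm_blaschke a ξ)⟩

end ModelSpaces

end

/-!
The functions `e_k = √(1 - |a|²) / (1 - conj a * ξ) * b_a ^ k`, `k ∈ ℤ`, form an orthonormal basis
of `L²`, and those with `0 ≤ k < n` form one of the model space of `b_a ^ n`. The factor `b_a`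
carries the Poisson measure of `a`, whose density is `|e_0|²`, to arc length, so in the latter basis
the compression of `T_φ` is the `n × n` Toeplitz matrix with symbol `φ ∘ b_{-a}`. It remains to
prove Szegő's theorem for a real symbol `h ∈ L²`. An eigenvalue with unit eigenvector `x` is the
mean of `h` for the probability measure `|p|² dm`, where `p` is the polynomial with coefficients
`x`, and for an orthonormal basis of eigenvectors these `n` measures add up to `n • dm`. By
Parseval's identity the mean of the squares of the eigenvalues tends to `∫ h²`, so the average
variance of `h` under these measures tends to `0`, and for uniformly continuous `H` the mean of `H`
over the eigenvalues is asymptotically `∫ H ∘ h`.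
-/

noncomputable section

namespace ModelSpaces

section Variance

open ProbabilityTheory

theorem exists_norm_sub_le_add_mul_dist_sq {X E : Type*} [PseudoMetricSpace X]
    [SeminormedAddCommGroup E] {H : X → E} (hH : UniformContinuous H) {M : ℝ}
    (hM : ∀ x, ‖H x‖ ≤ M) {ε : ℝ} (hε : 0 < ε) :
    ∃ C, ∀ x y, ‖H x - H y‖ ≤ ε + C * dist x y ^ 2 := by
  obtain ⟨δ, hδ, hclose⟩ := Metric.uniformContinuous_iff.mp hH ε hε
  refine ⟨2 * M / δ ^ 2, fun x y => ?_⟩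
  have hM0 : 0 ≤ M := (norm_nonneg _).trans (hM x)
  rcases lt_or_ge (dist x y) δ with hxy | hxy
  · have hHxy : ‖H x - H y‖ < ε := by simpa only [dist_eq_norm] using hclose hxy
    have : 0 ≤ 2 * M / δ ^ 2 * dist x y ^ 2 := by positivity
    linarith
  · calc ‖H x - H y‖ ≤ 2 * M := (norm_sub_le _ _).trans (by linarith [hM x, hM y])
      _ = 2 * M / δ ^ 2 * δ ^ 2 := by field_simp
      _ ≤ 2 * M / δ ^ 2 * dist x y ^ 2 := by gcongr
      _ ≤ ε + 2 * M / δ ^ 2 * dist x y ^ 2 := le_add_of_nonneg_left hε.le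

variable {Ω E : Type*} [MeasurableSpace Ω] [NormedAddCommGroup E] {H : ℝ → E} {f : Ω → ℝ}

section Probability

variable {ν : Measure Ω} [IsProbabilityMeasure ν] {ε C : ℝ}

theorem integrable_comp_of_norm_sub_le (hf : MemLp f 2 ν) (hH : Continuous H)
    (hC : ∀ x y, ‖H x - H y‖ ≤ ε + C * dist x y ^ 2) : Integrable (fun ω => H (f ω)) ν := by
  have hbound : Integrable (fun ω => ‖H 0‖ + (ε + C * f ω ^ 2)) ν :=
    (integrable_const _).add ((integrable_const ε).add (hf.integrable_sq.const_mul C))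
  refine hbound.mono' (hH.comp_aestronglyMeasurable hf.1) (Eventually.of_forall fun ω => ?_)
  calc ‖H (f ω)‖ ≤ ‖H 0‖ + ‖H (f ω) - H 0‖ := norm_le_norm_add_norm_sub' _ _
    _ ≤ ‖H 0‖ + (ε + C * f ω ^ 2) := by simpa using hC (f ω) 0

theorem norm_integral_comp_sub_le_variance [NormedSpace ℝ E] [CompleteSpace E] (hf : MemLp f 2 ν)
    (hH : Continuous H) (hC : ∀ x y, ‖H x - H y‖ ≤ ε + C * dist x y ^ 2) :
    ‖∫ ω, H (f ω) ∂ν - H (∫ ω, f ω ∂ν)‖ ≤ ε + C * Var[f; ν] := by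
  set m := ∫ ω, f ω ∂ν
  have hsq : Integrable (fun ω => (f ω - m) ^ 2) ν := (hf.sub (memLp_const m)).integrable_sq
  calc ‖∫ ω, H (f ω) ∂ν - H m‖ = ‖∫ ω, (H (f ω) - H m) ∂ν‖ := by
        rw [integral_sub (integrable_comp_of_norm_sub_le hf hH hC) (integrable_const _)]
        simp
    _ ≤ ∫ ω, (ε + C * (f ω - m) ^ 2) ∂ν := by
        refine norm_integral_le_of_norm_le ((integrable_const ε).add (hsq.const_mul C))
          (Eventually.of_forall fun ω => ?_)
        simpa only [Real.dist_eq, sq_abs] using hC (f ω) m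
    _ = ε + C * Var[f; ν] := by
        rw [integral_add (integrable_const ε) (hsq.const_mul C), integral_const_mul,
          variance_eq_integral hf.aemeasurable]
        simp [m]

end Probability

variable {μ : Measure Ω}

section Family

variable {ι : Type*} [Fintype ι] {ν : ι → Measure Ω}
  (hν : ∑ i, ν i = (Fintype.card ι : ℝ≥0∞) • μ)
include hν

theorem sum_integral_of_sum_eq_card_smul [NormedSpace ℝ E] {g : Ω → E}
    (hg : ∀ i, Integrable g (ν i)) :
    ∑ i, ∫ ω, g ω ∂ν i = (Fintype.card ι : ℝ) • ∫ ω, g ω ∂μ := by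
  rw [← integral_finsetSum_measure fun i _ => hg i, hν, integral_smul_measure,
    ENNReal.toReal_natCast]

theorem memLp_of_sum_eq_card_smul {g : Ω → E} {p : ℝ≥0∞} (hg : MemLp g p μ) (i : ι) :
    MemLp g p (ν i) := by
  have hle : ν i ≤ (Fintype.card ι : ℝ≥0∞) • μ :=
    hν ▸ Finset.single_le_sum (fun _ _ => Measure.zero_le _) (Finset.mem_univ i)
  exact (hg.smul_measure (ENNReal.natCast_ne_top _)).mono_measure hle

theorem norm_sum_comp_integral_sub_le [∀ i, IsProbabilityMeasure (ν i)] [NormedSpace ℝ E]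
    [CompleteSpace E] {ε C : ℝ} (hf : MemLp f 2 μ) (hH : Continuous H)
    (hC : ∀ x y, ‖H x - H y‖ ≤ ε + C * dist x y ^ 2) :
    ‖(Fintype.card ι : ℝ) • ∫ ω, H (f ω) ∂μ - ∑ i, H (∫ ω, f ω ∂ν i)‖ ≤
      Fintype.card ι * (ε + C * ∫ ω, f ω ^ 2 ∂μ) - C * ∑ i, (∫ ω, f ω ∂ν i) ^ 2 := by
  have hfν := memLp_of_sum_eq_card_smul hν hf
  rw [← sum_integral_of_sum_eq_card_smul hν
    fun i => integrable_comp_of_norm_sub_le (hfν i) hH hC, ← Finset.sum_sub_distrib]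
  calc ‖∑ i, (∫ ω, H (f ω) ∂ν i - H (∫ ω, f ω ∂ν i))‖ ≤ ∑ i, (ε + C * Var[f; ν i]) :=
        norm_sum_le_of_le _ fun i _ => norm_integral_comp_sub_le_variance (hfν i) hH hC
    _ = Fintype.card ι * ε + C * (∑ i, ∫ ω, f ω ^ 2 ∂ν i - ∑ i, (∫ ω, f ω ∂ν i) ^ 2) := by
        simp only [fun i => variance_eq_sub (hfν i), Finset.sum_add_distrib, ← Finset.mul_sum,
          Finset.sum_sub_distrib, Pi.pow_apply, Finset.sum_const, Finset.card_univ, nsmul_eq_mul]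
    _ = _ := by
        rw [sum_integral_of_sum_eq_card_smul hν fun i => (hfν i).integrable_sq, smul_eq_mul]
        ring

end Family

theorem tendsto_mean_comp_integral [NormedSpace ℝ E] [CompleteSpace E]
    {ν : ∀ n : ℕ, Fin n → Measure Ω} [∀ n i, IsProbabilityMeasure (ν n i)]
    (hν : ∀ n, ∑ i, ν n i = (n : ℝ≥0∞) • μ) (hf : MemLp f 2 μ)
    (hsq : Tendsto (fun n : ℕ => (n : ℝ)⁻¹ * ∑ i, (∫ ω, f ω ∂ν n i) ^ 2) atTop
      (𝓝 (∫ ω, f ω ^ 2 ∂μ)))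
    (hH : UniformContinuous H) {M : ℝ} (hM : ∀ x, ‖H x‖ ≤ M) :
    Tendsto (fun n : ℕ => (n : ℝ)⁻¹ • ∑ i, H (∫ ω, f ω ∂ν n i)) atTop
      (𝓝 (∫ ω, H (f ω) ∂μ)) := by
  rw [Metric.tendsto_nhds]
  intro ε hε
  obtain ⟨C, hC⟩ := exists_norm_sub_le_add_mul_dist_sq hH hM (half_pos hε)
  have hvar := (hsq.const_sub (∫ ω, f ω ^ 2 ∂μ)).const_mul C
  rw [sub_self, mul_zero] at hvar
  filter_upwards [hvar.eventually_lt_const (half_pos hε), eventually_gt_atTop 0] with n hn hn0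
  have hn0 : (0 : ℝ) < n := Nat.cast_pos.mpr hn0
  have hle := norm_sum_comp_integral_sub_le (ν := ν n) (by simpa using hν n) hf hH.continuous hC
  rw [Fintype.card_fin] at hle
  rw [dist_comm, dist_eq_norm]
  calc ‖∫ ω, H (f ω) ∂μ - (n : ℝ)⁻¹ • ∑ i, H (∫ ω, f ω ∂ν n i)‖
      = (n : ℝ)⁻¹ * ‖(n : ℝ) • ∫ ω, H (f ω) ∂μ - ∑ i, H (∫ ω, f ω ∂ν n i)‖ := by
        rw [← norm_smul_of_nonneg (inv_nonneg.mpr hn0.le), smul_sub, inv_smul_smul₀ hn0.ne']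
    _ ≤ ε / 2 + C * (∫ ω, f ω ^ 2 ∂μ - (n : ℝ)⁻¹ * ∑ i, (∫ ω, f ω ∂ν n i) ^ 2) := by
        refine (mul_le_mul_of_nonneg_left hle (inv_nonneg.mpr hn0.le)).trans_eq ?_
        field_simp
        ring
    _ < ε := by linarith

end Variance

section ToeplitzSums

theorem sum_Icc_neg_eq_sum_range {M : Type*} [AddCommMonoid M] (c : ℤ → M) (n : ℕ) :
    ∑ m ∈ Finset.Icc (-n : ℤ) n, c m =
      ∑ j ∈ Finset.range n, (c (j - n) + c (n - j)) + c 0 := by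
  induction n with
  | zero => simp
  | succ n ih =>
    have hdisj : Disjoint (Finset.Icc (-n : ℤ) n) {(-(n + 1) : ℤ), (n + 1 : ℤ)} := by simp
    rw [Nat.cast_succ, Finset.Icc_succ_succ, Finset.sum_union hdisj, ih,
      Finset.sum_pair (by lia), Finset.sum_range_succ']
    simp only [Nat.cast_succ, add_sub_add_right_eq_sub, Nat.cast_zero, zero_sub, sub_zero]
    abel

theorem sum_range_sum_range_sub {M : Type*} [AddCommMonoid M] (c : ℤ → M) (n : ℕ) :
    ∑ j ∈ Finset.range n, ∑ k ∈ Finset.range n, c (j - k) =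
      ∑ m ∈ Finset.range n, ∑ i ∈ Finset.Icc (-m : ℤ) m, c i := by
  induction n with
  | zero => simp
  | succ n ih =>
    simp only [Finset.sum_range_succ, Finset.sum_add_distrib, ih, sum_Icc_neg_eq_sum_range]
    simp only [sub_self]
    abel

theorem tendsto_mean_sum_toeplitz {E : Type*} [NormedAddCommGroup E] [NormedSpace ℝ E]
    {c : ℤ → E} {s : E} (hc : HasSum c s) :
    Tendsto (fun n : ℕ => (n : ℝ)⁻¹ • ∑ j : Fin n, ∑ k : Fin n, c ((j : ℤ) - k)) atTop (𝓝 s) := by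
  have hpartial : Tendsto (fun m : ℕ => ∑ i ∈ Finset.Icc (-m : ℤ) m, c i) atTop (𝓝 s) :=
    hc.comp Finset.tendsto_Icc_neg
  refine hpartial.cesaro_smul.congr fun n => ?_
  rw [← sum_range_sum_range_sub, Finset.sum_range]
  simp only [Finset.sum_range]

end ToeplitzSums

section Spectrum

theorem sum_sq_eigenvalues_eq_sum_sq_norm {𝕜 ι : Type*} [RCLike 𝕜] [Fintype ι] [DecidableEq ι]
    {A : Matrix ι ι 𝕜} (hA : A.IsHermitian) :
    ∑ i, hA.eigenvalues i ^ 2 = ∑ j, ∑ k, ‖A j k‖ ^ 2 := by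
  have hAA : (A * A).trace = ∑ j, ∑ k, ((‖A j k‖ ^ 2 : ℝ) : 𝕜) := by
    nth_rw 1 [← hA.eq]
    rw [Finset.sum_comm]
    simp [Matrix.trace, Matrix.mul_apply, RCLike.conj_mul]
  have hD : (A * A).trace = ∑ i, ((hA.eigenvalues i ^ 2 : ℝ) : 𝕜) := by
    conv_lhs => rw [hA.spectral_theorem, ← map_mul, Unitary.conjStarAlgAut_apply,
      Matrix.trace_mul_comm, ← mul_assoc]
    simp [Matrix.trace, sq]
  exact_mod_cast hD.symm.trans hAA

section Symmetric

variable {𝕜 V : Type*} [RCLike 𝕜] [NormedAddCommGroup V] [InnerProductSpace 𝕜 V]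
  [FiniteDimensional 𝕜 V] {T : V →ₗ[𝕜] V} (hT : T.IsSymmetric)
include hT

theorem roots_charpoly_adjoint_comp_self {n : ℕ} (hn : Module.finrank 𝕜 V = n) :
    (T.adjoint ∘ₗ T).charpoly.roots =
      Finset.univ.val.map fun i => ((hT.eigenvalues hn i ^ 2 : ℝ) : 𝕜) := by
  have hadj : T.adjoint = T := (LinearMap.isSymmetric_iff_isSelfAdjoint T).mp hT
  have hdiag : LinearMap.toMatrix (hT.eigenvectorBasis hn).toBasis
      (hT.eigenvectorBasis hn).toBasis (T.adjoint ∘ₗ T) =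
        Matrix.diagonal fun i => ((hT.eigenvalues hn i ^ 2 : ℝ) : 𝕜) := by
    rw [hadj, LinearMap.toMatrix_comp _ (hT.eigenvectorBasis hn).toBasis,
      hT.toMatrix_eigenvectorBasis, Matrix.diagonal_mul_diagonal]
    simp [sq]
  rw [← LinearMap.charpoly_toMatrix _ (hT.eigenvectorBasis hn).toBasis, hdiag,
    Matrix.charpoly_diagonal, Polynomial.roots_prod _ _
      (Finset.prod_ne_zero_iff.mpr fun i _ => Polynomial.X_sub_C_ne_zero _)]
  simp only [Polynomial.roots_X_sub_C, Multiset.bind_singleton]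

theorem map_singularValues_eq_map_norm_roots_charpoly :
    (Multiset.range (Module.finrank 𝕜 V)).map T.singularValues =
      T.charpoly.roots.map (‖·‖) := by
  have hsq := (T.isSymmetric_adjoint_comp_self.roots_charpoly_eq_eigenvalues rfl).symm.trans
    (roots_charpoly_adjoint_comp_self hT rfl)
  have hsqrt := congrArg (Multiset.map fun z : 𝕜 => √(RCLike.re z)) hsq
  have hrange : Multiset.range (Module.finrank 𝕜 V) =
      Finset.univ.val.map fun i : Fin (Module.finrank 𝕜 V) => (i : ℕ) := by
    simp [Fin.univ_val_map, List.ofFn_eq_map, Multiset.range]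
  simp only [Multiset.map_map, Function.comp_def, RCLike.ofReal_re, Real.sqrt_sq_eq_abs] at hsqrt
  simp only [hT.roots_charpoly_eq_eigenvalues rfl, hrange, Multiset.map_map, Function.comp_def,
    RCLike.norm_ofReal, ← hsqrt, T.singularValues_fin rfl]

end Symmetric

end Spectrum

section Circle

theorem integral_circleMeasure_eq_circleAverage {E : Type*} [NormedAddCommGroup E]
    [NormedSpace ℝ E] (g : ℂ → E) :
    ∫ ξ : Circle, g ξ ∂circleMeasure = Real.circleAverage g 0 1 := by
  have : Fact (0 < 2 * Real.pi) := ⟨Real.two_pi_pos⟩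
  have hmap : MeasurableEmbedding (AddCircle.toCircle : AddCircle (2 * Real.pi) → Circle) := by
    rw [← funext (AddCircle.homeomorphCircle_apply Real.two_pi_pos.ne')]
    exact (AddCircle.homeomorphCircle Real.two_pi_pos.ne').measurableEmbedding
  rw [circleMeasure, hmap.integral_map, AddCircle.integral_haarAddCircle,
    ← AddCircle.intervalIntegral_preimage (2 * Real.pi) 0, Real.circleAverage]
  simp [AddCircle.toCircle_apply_mk, circleMap]

theorem dense_span_mul_comp {X Y ι : Type*} [TopologicalSpace X] [CompactSpace X]
    [TopologicalSpace Y] {b : ι → C(Y, ℂ)}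
    (hb : Dense (Submodule.span ℂ (Set.range b) : Set C(Y, ℂ))) (φ : X ≃ₜ Y)
    {w : C(X, ℂ)} (hw : ∀ x, w x ≠ 0) :
    Dense (Submodule.span ℂ (Set.range fun i => w * (b i).comp φ) : Set C(X, ℂ)) := by
  let L : C(Y, ℂ) →ₗ[ℂ] C(X, ℂ) :=
    LinearMap.mulLeft ℂ w ∘ₗ (ContinuousMap.compRightAlgHom ℂ ℂ (φ : C(X, Y))).toLinearMap
  have hLc : Continuous L :=
    continuous_const.mul (ContinuousMap.compRightAlgHom_continuous ℂ ℂ (φ : C(X, Y)))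
  have hL : Function.Surjective L := fun u => by
    refine ⟨⟨fun y => (w (φ.symm y))⁻¹ * u (φ.symm y),
      ((by fun_prop : Continuous fun y => w (φ.symm y)).inv₀ fun y => hw _).mul
        (by fun_prop)⟩, ?_⟩
    ext x
    simp [L, hw]
  have h := hL.denseRange.dense_image hLc hb
  rwa [← Submodule.map_coe, Submodule.map_span, ← Set.range_comp] at h

theorem dense_span_monomial : Dense (Submodule.span ℂ (Set.range monomial) : Set C(Circle, ℂ)) := by
  have : Fact (0 < 2 * Real.pi) := ⟨Real.two_pi_pos⟩
  let φ := AddCircle.homeomorphCircle Real.two_pi_pos.ne'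
  have hfourier := Submodule.dense_iff_topologicalClosure_eq_top.mpr
    (span_fourier_closure_eq_top (T := 2 * Real.pi))
  have hmonomial (n : ℤ) : 1 * (fourier n).comp (φ.symm : C(Circle, AddCircle (2 * Real.pi))) =
      monomial n := by
    ext ξ
    have hξ : AddCircle.toCircle (φ.symm ξ) = ξ := by
      rw [← AddCircle.homeomorphCircle_apply Real.two_pi_pos.ne', Homeomorph.apply_symm_apply]
    simp [monomial, fourier_apply, AddCircle.toCircle_zsmul, hξ]
  simpa only [hmonomial] using
    dense_span_mul_comp hfourier φ.symm (w := 1) fun _ => one_ne_zero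

theorem dense_span_toLp {X ι : Type*} [TopologicalSpace X] [CompactSpace X] [NormalSpace X]
    [R1Space X] [MeasurableSpace X] [BorelSpace X] [SecondCountableTopologyEither X ℂ]
    {μ : Measure X} [μ.WeaklyRegular] [IsFiniteMeasure μ] {b : ι → C(X, ℂ)}
    (hb : Dense (Submodule.span ℂ (Set.range b) : Set C(X, ℂ))) {p : ℝ≥0∞} [Fact (1 ≤ p)]
    (hp : p ≠ ∞) :
    Dense (Submodule.span ℂ (Set.range fun i => (b i).toLp p μ ℂ) : Set (Lp ℂ p μ)) := by
  have h := (ContinuousMap.toLp_denseRange ℂ μ ℂ hp).dense_image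
    (ContinuousMap.toLp p μ ℂ).continuous hb
  rwa [← ContinuousLinearMap.coe_coe, ← Submodule.map_coe, Submodule.map_span,
    ← Set.range_comp] at h

theorem ext_of_integral_eq_of_dense_span {X ι : Type*} [TopologicalSpace X] [CompactSpace X]
    [HasOuterApproxClosed X] [MeasurableSpace X] [BorelSpace X]
    {μ ν : Measure X} [IsFiniteMeasure μ] [IsFiniteMeasure ν] {b : ι → C(X, ℂ)}
    (hb : Dense (Submodule.span ℂ (Set.range b) : Set C(X, ℂ)))
    (h : ∀ i, ∫ x, b i x ∂μ = ∫ x, b i x ∂ν) : μ = ν := by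
  let Λ (ρ : Measure X) [IsFiniteMeasure ρ] : C(X, ℂ) →L[ℂ] ℂ :=
    innerSL ℂ ((1 : C(X, ℂ)).toLp 2 ρ ℂ) ∘L ContinuousMap.toLp 2 ρ ℂ
  have hΛ (ρ : Measure X) [IsFiniteMeasure ρ] (u : C(X, ℂ)) : Λ ρ u = ∫ x, u x ∂ρ := by
    simp [Λ, ContinuousMap.inner_toLp]
  have hμν : Λ μ = Λ ν := ContinuousLinearMap.ext_on hb <| by
    rintro _ ⟨i, rfl⟩
    rw [hΛ, hΛ, h]
  refine ext_of_forall_integral_eq_of_IsFiniteMeasure fun u => ?_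
  have hu := congrArg (· (⟨fun x => (u x : ℂ), by fun_prop⟩ : C(X, ℂ))) hμν
  simp only [hΛ, ContinuousMap.coe_mk, integral_complex_ofReal] at hu
  exact_mod_cast hu

theorem integral_poissonKernel_smul {E : Type*} [NormedAddCommGroup E] [NormedSpace ℂ E]
    [CompleteSpace E] {f : ℂ → E} (hf : DiffContOnCl ℂ f (Metric.ball 0 1)) (a : 𝔻) :
    ∫ ξ : Circle, poissonKernel 0 a ξ • f ξ ∂circleMeasure = f a :=
  (integral_circleMeasure_eq_circleAverage (poissonKernel 0 (a : ℂ) • f)).trans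
    (hf.circleAverage_poissonKernel_smul (by simpa using a.norm_lt_one))

theorem integral_circleMeasure_of_diffContOnCl {E : Type*} [NormedAddCommGroup E]
    [NormedSpace ℂ E] [CompleteSpace E] {f : ℂ → E} (hf : DiffContOnCl ℂ f (Metric.ball 0 1)) :
    ∫ ξ : Circle, f ξ ∂circleMeasure = f 0 :=
  (integral_circleMeasure_eq_circleAverage f).trans <| DiffContOnCl.circleAverage <| by
    rwa [abs_one]

theorem integral_pow_succ_circleMeasure (k : ℕ) :
    ∫ ξ : Circle, (ξ : ℂ) ^ (k + 1) ∂circleMeasure = 0 := by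
  simpa using integral_circleMeasure_of_diffContOnCl (f := fun z : ℂ => z ^ (k + 1))
    (by fun_prop : Differentiable ℂ _).diffContOnCl

theorem integral_monomial_eq_ite {μ : Measure Circle} [IsProbabilityMeasure μ]
    (h : ∀ k : ℕ, ∫ ξ : Circle, (ξ : ℂ) ^ (k + 1) ∂μ = 0) (n : ℤ) :
    ∫ ξ, monomial n ξ ∂μ = if n = 0 then 1 else 0 := by
  rcases n with (_ | k) | k
  · simp [monomial]
  · rw [if_neg (by simp [Nat.cast_add_one_ne_zero]), ← h k]
    exact integral_congr_ae (ae_of_all _ fun ξ => by simp [monomial, ← zpow_natCast])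
  · rw [if_neg (Int.negSucc_ne_zero k), ← map_zero (starRingEnd ℂ), ← h k, ← integral_conj]
    exact integral_congr_ae (ae_of_all _ fun ξ => by
      simp only [monomial, ContinuousMap.coe_mk, zpow_negSucc, Circle.coe_inv_eq_conj,
        Circle.coe_pow])

theorem eq_circleMeasure_of_integral_pow_succ {μ : Measure Circle} [IsProbabilityMeasure μ]
    (h : ∀ k : ℕ, ∫ ξ : Circle, (ξ : ℂ) ^ (k + 1) ∂μ = 0) : μ = circleMeasure :=
  ext_of_integral_eq_of_dense_span dense_span_monomial fun n => by
    rw [integral_monomial_eq_ite h, integral_monomial_eq_ite integral_pow_succ_circleMeasure]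

theorem circleCoeff_one (n : ℤ) : circleCoeff (fun _ => 1) n = if n = 0 then 1 else 0 := by
  simpa [circleCoeff, monomial] using
    integral_monomial_eq_ite integral_pow_succ_circleMeasure (-n)

theorem inner_toLp_left {X : Type*} [TopologicalSpace X] [CompactSpace X] [MeasurableSpace X]
    [BorelSpace X] [SecondCountableTopologyEither X ℂ] {μ : Measure X} [IsFiniteMeasure μ]
    (u : C(X, ℂ)) (f : Lp ℂ 2 μ) :
    inner ℂ (u.toLp 2 μ ℂ) f = ∫ x, starRingEnd ℂ (u x) * f x ∂μ := by
  rw [L2.inner_def]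
  refine integral_congr_ae ?_
  filter_upwards [ContinuousMap.coeFn_toLp (p := 2) (𝕜 := ℂ) μ u] with x hx
  rw [hx, RCLike.inner_apply']

theorem orthonormal_monomial : Orthonormal ℂ fun n => (monomial n).toLp 2 circleMeasure ℂ := by
  rw [orthonormal_iff_ite]
  intro m n
  have hmn (ξ : Circle) : monomial n ξ * starRingEnd ℂ (monomial m ξ) = monomial (n - m) ξ := by
    simp [monomial, zpow_sub₀, ← Circle.coe_inv_eq_conj, div_eq_mul_inv]
  simp only [ContinuousMap.inner_toLp, hmn,
    integral_monomial_eq_ite integral_pow_succ_circleMeasure, sub_eq_zero, eq_comm]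

/-- The Hilbert basis of `L²` formed by the monomials, that is, the Fourier basis. -/
def monomialBasis : HilbertBasis ℤ ℂ L2 :=
  HilbertBasis.mk orthonormal_monomial <| le_of_eq <| Eq.symm <|
    Submodule.dense_iff_topologicalClosure_eq_top.mp <|
      dense_span_toLp dense_span_monomial ENNReal.ofNat_ne_top

theorem inner_monomialBasis (n : ℤ) (f : L2) : inner ℂ (monomialBasis n) f = circleCoeff f n := by
  rw [monomialBasis, HilbertBasis.coe_mk, inner_monomial]

theorem circleCoeff_congr_ae {f g : Circle → ℂ} (h : f =ᵐ[circleMeasure] g) (n : ℤ) :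
    circleCoeff f n = circleCoeff g n :=
  integral_congr_ae (h.mono fun ξ hξ => by simp only [hξ])

theorem hasSum_norm_sq_circleCoeff {h : Circle → ℂ} (hh : MemLp h 2 circleMeasure) :
    HasSum (fun n => ‖circleCoeff h n‖ ^ 2) (∫ ξ, ‖h ξ‖ ^ 2 ∂circleMeasure) := by
  have hsum := monomialBasis.hasSum_inner_mul_inner hh.toLp hh.toLp
  have hnorm : (inner ℂ hh.toLp hh.toLp : ℂ) = ((∫ ξ, ‖h ξ‖ ^ 2 ∂circleMeasure : ℝ) : ℂ) := by
    rw [L2.inner_def, ← integral_complex_ofReal]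
    refine integral_congr_ae (hh.coeFn_toLp.mono fun ξ hξ => ?_)
    simp [hξ]
  rw [hnorm] at hsum
  have hcoeff (n : ℤ) : inner ℂ hh.toLp (monomialBasis n) * inner ℂ (monomialBasis n) hh.toLp =
      ((‖circleCoeff h n‖ ^ 2 : ℝ) : ℂ) := by
    rw [← inner_conj_symm, inner_monomialBasis, circleCoeff_congr_ae hh.coeFn_toLp,
      Complex.conj_mul', Complex.ofReal_pow]
  simpa only [hcoeff, Complex.hasSum_ofReal] using hsum

end Circle

section Density

variable {Ω : Type*} [MeasurableSpace Ω] {μ : Measure Ω}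

theorem integral_withDensity_ofReal {E : Type*} [NormedAddCommGroup E] [NormedSpace ℝ E]
    {w : Ω → ℝ} (hw : Measurable w) (hw0 : ∀ ω, 0 ≤ w ω) (g : Ω → E) :
    ∫ ω, g ω ∂μ.withDensity (fun ω => ENNReal.ofReal (w ω)) = ∫ ω, w ω • g ω ∂μ := by
  rw [integral_withDensity_eq_integral_toReal_smul hw.ennreal_ofReal
    (ae_of_all _ fun _ => ENNReal.ofReal_lt_top)]
  simp only [ENNReal.toReal_ofReal (hw0 _)]

theorem isProbabilityMeasure_withDensity_ofReal {w : Ω → ℝ} (hw : Integrable w μ)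
    (hw0 : ∀ ω, 0 ≤ w ω) (h : ∫ ω, w ω ∂μ = 1) :
    IsProbabilityMeasure (μ.withDensity fun ω => ENNReal.ofReal (w ω)) :=
  ⟨by
    rw [withDensity_apply _ MeasurableSet.univ, Measure.restrict_univ,
      ← ofReal_integral_eq_lintegral_ofReal hw (ae_of_all _ hw0), h,
      ENNReal.ofReal_one]⟩

theorem sum_withDensity {ι : Type*} {f : ι → Ω → ℝ≥0∞} (hf : ∀ i, Measurable (f i))
    (s : Finset ι) :
    ∑ i ∈ s, μ.withDensity (f i) = μ.withDensity fun ω => ∑ i ∈ s, f i ω := by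
  ext t ht
  simp only [Measure.finsetSum_apply, withDensity_apply _ ht,
    lintegral_finsetSum _ fun i _ => hf i]

end Density

section Szego

open scoped Matrix

/-- The `n × n` Toeplitz matrix with symbol `h`, whose entries are Fourier coefficients of `h`. -/
def toeplitzMatrix (h : Circle → ℂ) (n : ℕ) : Matrix (Fin n) (Fin n) ℂ :=
  Matrix.of fun j k => circleCoeff h (j - k)

theorem isHermitian_toeplitzMatrix (f : Circle → ℝ) (n : ℕ) :
    (toeplitzMatrix (fun ξ => (f ξ : ℂ)) n).IsHermitian := by
  refine Matrix.IsHermitian.ext fun j k => ?_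
  simp only [toeplitzMatrix, Matrix.of_apply, circleCoeff, RCLike.star_def, ← integral_conj]
  refine integral_congr_ae (ae_of_all _ fun ξ => ?_)
  beta_reduce
  rw [map_mul, map_zpow₀, ← Circle.coe_inv_eq_conj, Complex.conj_ofReal, Circle.coe_inv, inv_zpow',
    neg_neg, neg_sub]

theorem toeplitzMatrix_congr_ae {g h : Circle → ℂ} (hgh : g =ᵐ[circleMeasure] h) (n : ℕ) :
    toeplitzMatrix g n = toeplitzMatrix h n := by
  ext j k
  exact circleCoeff_congr_ae hgh _

theorem toeplitzMatrix_one (n : ℕ) : toeplitzMatrix (fun _ => 1) n = 1 := by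
  ext j k
  simp [toeplitzMatrix, circleCoeff_one, Matrix.one_apply, Fin.ext_iff, sub_eq_zero]

/-- The vector for which `⟪expVector n ξ, x⟫` is the value at `ξ` of the polynomial with
coefficients `x`. -/
def expVector (n : ℕ) (ξ : Circle) : EuclideanSpace ℂ (Fin n) :=
  WithLp.toLp 2 fun k => (ξ : ℂ) ^ (-(k : ℤ))

theorem norm_sq_expVector (n : ℕ) (ξ : Circle) : ‖expVector n ξ‖ ^ 2 = n := by
  simp [expVector, EuclideanSpace.norm_sq_eq, Circle.norm_coe]

theorem inner_expVector {n : ℕ} (ξ : Circle) (x : EuclideanSpace ℂ (Fin n)) :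
    inner ℂ (expVector n ξ) x = ∑ k : Fin n, (ξ : ℂ) ^ (k : ℕ) * x k := by
  simp [expVector, PiLp.inner_apply, ← Circle.coe_inv_eq_conj, mul_comm]

theorem measurable_norm_sq_inner_expVector {n : ℕ} (x : EuclideanSpace ℂ (Fin n)) :
    Measurable fun ξ => ‖inner ℂ (expVector n ξ) x‖ ^ 2 := by
  simp only [inner_expVector]
  fun_prop

theorem norm_sq_inner_expVector {n : ℕ} (ξ : Circle) (x : EuclideanSpace ℂ (Fin n)) :
    ((‖inner ℂ (expVector n ξ) x‖ ^ 2 : ℝ) : ℂ) =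
      ∑ j : Fin n, ∑ k : Fin n, star (x j) * (ξ : ℂ) ^ (-((j : ℤ) - k)) * x k := by
  rw [Complex.ofReal_pow, ← Complex.conj_mul', inner_expVector, map_sum, Finset.sum_mul_sum]
  refine Finset.sum_congr rfl fun j _ => Finset.sum_congr rfl fun k _ => ?_
  rw [map_mul, map_pow, ← Circle.coe_inv_eq_conj, neg_sub, zpow_sub₀ (Circle.coe_ne_zero ξ)]
  simp only [Circle.coe_inv, zpow_natCast, RCLike.star_def]
  ring

theorem dotProduct_toeplitzMatrix_mulVec {g : Circle → ℂ} (hg : Integrable g circleMeasure)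
    {n : ℕ} (x : EuclideanSpace ℂ (Fin n)) :
    star ⇑x ⬝ᵥ (toeplitzMatrix g n *ᵥ ⇑x) =
      ∫ ξ, ‖inner ℂ (expVector n ξ) x‖ ^ 2 • g ξ ∂circleMeasure := by
  have hint (m : ℤ) : Integrable (fun ξ : Circle => (ξ : ℂ) ^ m * g ξ) circleMeasure :=
    hg.bdd_mul (c := 1) (by simpa [monomial] using (monomial m).continuous.aestronglyMeasurable)
      (ae_of_all _ fun ξ => by simp [Circle.norm_coe])
  have hterm (ξ : Circle) : ‖inner ℂ (expVector n ξ) x‖ ^ 2 • g ξ =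
      ∑ j : Fin n, ∑ k : Fin n, star (x j) * (((ξ : ℂ) ^ (-((j : ℤ) - k)) * g ξ) * x k) := by
    rw [Complex.real_smul, norm_sq_inner_expVector, Finset.sum_mul]
    refine Finset.sum_congr rfl fun j _ => ?_
    rw [Finset.sum_mul]
    exact Finset.sum_congr rfl fun _ _ => by ring
  simp only [hterm]
  rw [integral_finsetSum _ fun j _ => integrable_finsetSum _ fun k _ =>
    ((hint _).mul_const _).const_mul _]
  simp only [integral_finsetSum _ fun _ _ => ((hint _).mul_const _).const_mul _,
    integral_const_mul, integral_mul_const]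
  simp only [dotProduct, Matrix.mulVec, Finset.mul_sum, Pi.star_apply]
  rfl

/-- The measure with density `|p|²`, where `p` is the polynomial with coefficients `x`. -/
def polyMeasure {n : ℕ} (x : EuclideanSpace ℂ (Fin n)) : Measure Circle :=
  circleMeasure.withDensity fun ξ => ENNReal.ofReal (‖inner ℂ (expVector n ξ) x‖ ^ 2)

theorem integral_polyMeasure {n : ℕ} (x : EuclideanSpace ℂ (Fin n)) {g : Circle → ℂ}
    (hg : Integrable g circleMeasure) :
    ∫ ξ, g ξ ∂polyMeasure x = star ⇑x ⬝ᵥ (toeplitzMatrix g n *ᵥ ⇑x) := by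
  rw [dotProduct_toeplitzMatrix_mulVec hg, polyMeasure, integral_withDensity_ofReal
    (measurable_norm_sq_inner_expVector x) fun _ => sq_nonneg _]

theorem isProbabilityMeasure_polyMeasure {n : ℕ} {x : EuclideanSpace ℂ (Fin n)} (hx : ‖x‖ = 1) :
    IsProbabilityMeasure (polyMeasure x) := by
  have hone : ∫ ξ, ‖inner ℂ (expVector n ξ) x‖ ^ 2 ∂circleMeasure = 1 := by
    have h := dotProduct_toeplitzMatrix_mulVec (integrable_const (1 : ℂ)) x
    rw [toeplitzMatrix_one, Matrix.one_mulVec, dotProduct_comm,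
      ← EuclideanSpace.inner_eq_star_dotProduct, inner_self_eq_norm_sq_to_K, hx] at h
    simp only [Complex.real_smul, mul_one, integral_complex_ofReal] at h
    simpa using (congrArg Complex.re h).symm
  exact isProbabilityMeasure_withDensity_ofReal (integrable_of_integral_eq_one hone)
    (fun _ => sq_nonneg _) hone

theorem sum_polyMeasure {n : ℕ} (b : OrthonormalBasis (Fin n) ℂ (EuclideanSpace ℂ (Fin n))) :
    ∑ i, polyMeasure (b i) = (n : ℝ≥0∞) • circleMeasure := by
  simp only [polyMeasure]
  rw [sum_withDensity fun i => (measurable_norm_sq_inner_expVector (b i)).ennreal_ofReal]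
  simp only [← ENNReal.ofReal_sum_of_nonneg fun _ _ => sq_nonneg _,
    b.sum_sq_norm_inner_left, norm_sq_expVector, ENNReal.ofReal_natCast, withDensity_const]

section RealSymbol

variable {f : Circle → ℝ}

theorem eigenvalues_toeplitzMatrix (hf : Integrable f circleMeasure) (n : ℕ) (i : Fin n) :
    (isHermitian_toeplitzMatrix f n).eigenvalues i =
      ∫ ξ, f ξ ∂polyMeasure ((isHermitian_toeplitzMatrix f n).eigenvectorBasis i) := by
  rw [Matrix.IsHermitian.eigenvalues_eq]
  exact (congrArg RCLike.re (integral_polyMeasure _ hf.ofReal)).symm.trans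
    (by rw [integral_ofReal, RCLike.ofReal_re])

theorem sum_sq_eigenvalues_toeplitzMatrix (f : Circle → ℝ) (n : ℕ) :
    ∑ i, (isHermitian_toeplitzMatrix f n).eigenvalues i ^ 2 =
      ∑ j : Fin n, ∑ k : Fin n, ‖circleCoeff (fun ξ => (f ξ : ℂ)) ((j : ℤ) - k)‖ ^ 2 :=
  sum_sq_eigenvalues_eq_sum_sq_norm _

theorem tendsto_mean_sq_eigenvalues_toeplitzMatrix (hf : MemLp f 2 circleMeasure) :
    Tendsto (fun n : ℕ => (n : ℝ)⁻¹ * ∑ i, (isHermitian_toeplitzMatrix f n).eigenvalues i ^ 2)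
      atTop (𝓝 (∫ ξ, f ξ ^ 2 ∂circleMeasure)) := by
  have h := tendsto_mean_sum_toeplitz (hasSum_norm_sq_circleCoeff (hf.ofReal (K := ℂ)))
  simpa [sum_sq_eigenvalues_toeplitzMatrix] using h

theorem tendsto_mean_eigenvalues_toeplitzMatrix {E : Type*} [NormedAddCommGroup E]
    [NormedSpace ℝ E] [CompleteSpace E] (hf : MemLp f 2 circleMeasure) {H : ℝ → E} {M : ℝ}
    (hH : UniformContinuous H) (hM : ∀ x, ‖H x‖ ≤ M) :
    Tendsto (fun n : ℕ => (n : ℝ)⁻¹ • ∑ i, H ((isHermitian_toeplitzMatrix f n).eigenvalues i))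
      atTop (𝓝 (∫ ξ, H (f ξ) ∂circleMeasure)) := by
  have hfi : Integrable f circleMeasure := hf.integrable one_le_two
  have hprob (n : ℕ) (i : Fin n) := isProbabilityMeasure_polyMeasure
    ((isHermitian_toeplitzMatrix f n).eigenvectorBasis.norm_eq_one i)
  have hsq := tendsto_mean_sq_eigenvalues_toeplitzMatrix hf
  simp only [eigenvalues_toeplitzMatrix hfi] at hsq ⊢
  exact tendsto_mean_comp_integral (fun n => sum_polyMeasure _) hf hsq hH hM

theorem tendsto_mean_roots_charpoly_toeplitzMatrix (hf : MemLp f 2 circleMeasure) {G : ℂ → ℂ}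
    (hG : Continuous G) (hGc : HasCompactSupport G) :
    Tendsto (fun n : ℕ =>
        (n : ℂ)⁻¹ * ((toeplitzMatrix (fun ξ => (f ξ : ℂ)) n).charpoly.roots.map G).sum)
      atTop (𝓝 (∫ ξ, G (f ξ) ∂circleMeasure)) := by
  obtain ⟨M, hM⟩ := hG.bounded_above_of_compact_support hGc
  refine (tendsto_mean_eigenvalues_toeplitzMatrix hf
    ((hGc.uniformContinuous_of_continuous hG).comp Complex.isometry_ofReal.uniformContinuous)
    fun x => hM x).congr fun n => ?_
  rw [(isHermitian_toeplitzMatrix f n).roots_charpoly_eq_eigenvalues, Multiset.map_map,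
    Complex.real_smul, Complex.ofReal_inv, Complex.ofReal_natCast]
  rfl

end RealSymbol

end Szego

section Blaschke

open scoped ComplexConjugate

theorem one_sub_conj_mul_ne_zero (a : 𝔻) {z : ℂ} (hz : ‖z‖ ≤ 1) : 1 - conj (a : ℂ) * z ≠ 0 := by
  refine sub_ne_zero.mpr fun h => ?_
  have hlt : ‖conj (a : ℂ) * z‖ < 1 := by
    rw [norm_mul, RCLike.norm_conj]
    exact mul_lt_one_of_nonneg_of_lt_one_left (norm_nonneg _) a.norm_lt_one hz
  rw [← h, norm_one] at hlt
  exact hlt.false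

theorem coe_blaschke (a : 𝔻) (ξ : Circle) :
    (blaschke a ξ : ℂ) = (ξ - a) / (1 - conj (a : ℂ) * ξ) :=
  rfl

theorem diffContOnCl_div_one_sub_conj_mul (a : 𝔻) {f : ℂ → ℂ} (hf : Differentiable ℂ f) :
    DiffContOnCl ℂ (fun z => f z / (1 - conj (a : ℂ) * z)) (Metric.ball 0 1) := by
  refine DifferentiableOn.diffContOnCl ?_
  rw [closure_ball 0 one_ne_zero]
  exact hf.differentiableOn.div (by fun_prop) fun z hz =>
    one_sub_conj_mul_ne_zero a (mem_closedBall_zero_iff.mp hz)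

theorem diffContOnCl_blaschke_pow (a : 𝔻) (k : ℕ) :
    DiffContOnCl ℂ (fun z : ℂ => ((z - a) / (1 - conj (a : ℂ) * z)) ^ k) (Metric.ball 0 1) :=
  (by fun_prop : Differentiable ℂ fun z : ℂ => z ^ k).comp_diffContOnCl
    (diffContOnCl_div_one_sub_conj_mul a (by fun_prop))

theorem blaschke_neg_blaschke (a : 𝔻) (ξ : Circle) : blaschke (-a) (blaschke a ξ) = ξ := by
  have h := div_mul_cancel₀ ((ξ : ℂ) - a) (one_sub_conj_mul_ne_zero a ξ.norm_coe.le)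
  have hneg := one_sub_conj_mul_ne_zero (-a) (blaschke a ξ).norm_coe.le
  apply Circle.ext
  rw [coe_blaschke, div_eq_iff hneg, coe_blaschke, Complex.UnitDisc.coe_neg, map_neg]
  linear_combination h

theorem continuous_blaschke (a : 𝔻) : Continuous (blaschke a) :=
  Continuous.subtype_mk (Continuous.div (by fun_prop) (by fun_prop) fun ξ =>
    one_sub_conj_mul_ne_zero a ξ.norm_coe.le) _

/-- The Blaschke factor `b_a` as a homeomorphism of the circle, with inverse `b_{-a}`. -/
def blaschkeHomeomorph (a : 𝔻) : Circle ≃ₜ Circle where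
  toFun := blaschke a
  invFun := blaschke (-a)
  left_inv := blaschke_neg_blaschke a
  right_inv ξ := by simpa using blaschke_neg_blaschke (-a) ξ
  continuous_toFun := continuous_blaschke a
  continuous_invFun := continuous_blaschke (-a)

/-- The Szegő kernel of the disc at `a`, divided by its norm in `H²`. -/
def szegoKernel (a : 𝔻) (z : ℂ) : ℂ :=
  √(1 - ‖(a : ℂ)‖ ^ 2) / (1 - conj (a : ℂ) * z)

theorem diffContOnCl_szegoKernel (a : 𝔻) :
    DiffContOnCl ℂ (szegoKernel a) (Metric.ball 0 1) :=
  diffContOnCl_div_one_sub_conj_mul a (differentiable_const _)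

theorem continuous_szegoKernel (a : 𝔻) : Continuous fun ξ : Circle => szegoKernel a ξ :=
  Continuous.div (by fun_prop) (by fun_prop) fun ξ => one_sub_conj_mul_ne_zero a ξ.norm_coe.le

theorem one_sub_norm_sq_pos (a : 𝔻) : 0 < 1 - ‖(a : ℂ)‖ ^ 2 := by
  nlinarith [a.norm_lt_one, norm_nonneg (a : ℂ)]

theorem szegoKernel_ne_zero (a : 𝔻) (ξ : Circle) : szegoKernel a ξ ≠ 0 :=
  div_ne_zero (by simpa using (Real.sqrt_pos.mpr (one_sub_norm_sq_pos a)).ne')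
    (one_sub_conj_mul_ne_zero a ξ.norm_coe.le)

theorem one_sub_conj_mul_coe (a : ℂ) (ξ : Circle) : 1 - conj a * ξ = ξ * conj ((ξ : ℂ) - a) := by
  rw [map_sub, mul_sub, Complex.mul_conj, Circle.normSq_coe, Complex.ofReal_one, mul_comm]

theorem norm_sq_szegoKernel (a : 𝔻) (ξ : Circle) :
    ‖szegoKernel a ξ‖ ^ 2 = poissonKernel 0 (a : ℂ) ξ := by
  rw [szegoKernel, one_sub_conj_mul_coe, poissonKernel_def, norm_div, norm_mul, RCLike.norm_conj,
    Circle.norm_coe, div_pow, Complex.norm_real, Real.norm_eq_abs, sq_abs,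
    Real.sq_sqrt (one_sub_norm_sq_pos a).le]
  simp [Circle.norm_coe]

/-- The Poisson measure of `a`: the harmonic measure of the disc seen from `a`. Its density is
the Poisson kernel, see `norm_sq_szegoKernel`. -/
def poissonMeasure (a : 𝔻) : Measure Circle :=
  circleMeasure.withDensity fun ξ => ENNReal.ofReal (‖szegoKernel a ξ‖ ^ 2)

theorem integral_poissonMeasure {E : Type*} [NormedAddCommGroup E] [NormedSpace ℝ E] (a : 𝔻)
    (g : Circle → E) :
    ∫ ξ, g ξ ∂poissonMeasure a = ∫ ξ : Circle, ‖szegoKernel a ξ‖ ^ 2 • g ξ ∂circleMeasure :=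
  integral_withDensity_ofReal ((continuous_szegoKernel a).norm.pow 2).measurable
    (fun _ => sq_nonneg _) g

theorem integral_poissonMeasure_of_diffContOnCl {E : Type*} [NormedAddCommGroup E]
    [NormedSpace ℂ E] [CompleteSpace E] {f : ℂ → E} (hf : DiffContOnCl ℂ f (Metric.ball 0 1))
    (a : 𝔻) : ∫ ξ : Circle, f ξ ∂poissonMeasure a = f a := by
  simp only [integral_poissonMeasure, norm_sq_szegoKernel, integral_poissonKernel_smul hf]

instance (a : 𝔻) : IsProbabilityMeasure (poissonMeasure a) := by
  have h : ∫ ξ : Circle, ‖szegoKernel a ξ‖ ^ 2 ∂circleMeasure = 1 := by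
    have h1 := integral_poissonMeasure_of_diffContOnCl (f := fun _ => (1 : ℂ))
      diffContOnCl_const a
    rw [integral_poissonMeasure] at h1
    simp only [Complex.real_smul, mul_one, integral_complex_ofReal] at h1
    exact_mod_cast h1
  exact isProbabilityMeasure_withDensity_ofReal (integrable_of_integral_eq_one h)
    (fun _ => sq_nonneg _) h

theorem exists_poissonMeasure_le_smul (a : 𝔻) :
    ∃ C : ℝ≥0∞, C ≠ ∞ ∧ poissonMeasure a ≤ C • circleMeasure := by
  obtain ⟨C, hC⟩ := isCompact_univ.exists_bound_of_continuousOn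
    ((continuous_szegoKernel a).norm.pow 2).continuousOn
  refine ⟨ENNReal.ofReal C, ENNReal.ofReal_ne_top, ?_⟩
  rw [← withDensity_const]
  exact withDensity_mono (ae_of_all _ fun ξ =>
    ENNReal.ofReal_le_ofReal ((le_abs_self _).trans (hC ξ trivial)))

-- `b_a` vanishes at `a`, so its positive powers have mean zero for `poissonMeasure a`.
theorem measurePreserving_blaschke (a : 𝔻) :
    MeasurePreserving (blaschke a) (poissonMeasure a) circleMeasure := by
  have hm := (continuous_blaschke a).measurable
  refine ⟨hm, ?_⟩
  have := Measure.isProbabilityMeasure_map (μ := poissonMeasure a) hm.aemeasurable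
  refine eq_circleMeasure_of_integral_pow_succ fun k => ?_
  rw [integral_map hm.aemeasurable (by fun_prop)]
  simp only [coe_blaschke]
  simpa using
    integral_poissonMeasure_of_diffContOnCl (diffContOnCl_blaschke_pow a (k + 1)) a

theorem measurePreserving_blaschke_neg (a : 𝔻) :
    MeasurePreserving (blaschke (-a)) circleMeasure (poissonMeasure a) :=
  (measurePreserving_blaschke a).symm (blaschkeHomeomorph a).toMeasurableEquiv

theorem integral_comp_blaschke_neg {E : Type*} [NormedAddCommGroup E] [NormedSpace ℝ E] (a : 𝔻)
    (g : Circle → E) :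
    ∫ ξ, g (blaschke (-a) ξ) ∂circleMeasure =
      ∫ ξ : Circle, ‖szegoKernel a ξ‖ ^ 2 • g ξ ∂circleMeasure := by
  rw [← integral_poissonMeasure, ← (measurePreserving_blaschke_neg a).integral_comp
    (blaschkeHomeomorph (-a)).measurableEmbedding]

theorem memLp_comp_blaschke_neg {E : Type*} [NormedAddCommGroup E] {p : ℝ≥0∞} (a : 𝔻)
    {g : Circle → E} (hg : MemLp g p circleMeasure) :
    MemLp (fun ξ => g (blaschke (-a) ξ)) p circleMeasure := by
  obtain ⟨C, hC, hle⟩ := exists_poissonMeasure_le_smul a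
  exact (hg.of_measure_le_smul hC hle).comp_measurePreserving (measurePreserving_blaschke_neg a)

theorem comp_blaschke_neg_ae_eq {E : Type*} {g h : Circle → E} (hgh : g =ᵐ[circleMeasure] h)
    (a : 𝔻) :
    (fun ξ => g (blaschke (-a) ξ)) =ᵐ[circleMeasure] fun ξ => h (blaschke (-a) ξ) :=
  (measurePreserving_blaschke_neg a).quasiMeasurePreserving.ae_eq_comp
    ((withDensity_absolutelyContinuous _ _).ae_eq hgh)

end Blaschke

section Takenaka

open scoped ComplexConjugate

variable (a : 𝔻)

/-- The Takenaka–Malmquist functions `√(1 - |a|²) / (1 - conj a * ξ) * b_a(ξ) ^ k`, for all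
integers `k`: those with `0 ≤ k < n` span the model space of `b_a ^ n`. -/
def takenaka (k : ℤ) : C(Circle, ℂ) :=
  ⟨fun ξ => szegoKernel a ξ, continuous_szegoKernel a⟩ *
    (monomial k).comp (blaschkeHomeomorph a : C(Circle, Circle))

theorem takenaka_apply (k : ℤ) (ξ : Circle) :
    takenaka a k ξ = szegoKernel a ξ * (blaschke a ξ : ℂ) ^ k := by
  simp [takenaka, monomial, blaschkeHomeomorph]

theorem conj_takenaka_mul_takenaka (j k : ℤ) (ξ : Circle) :
    conj (takenaka a j ξ) * takenaka a k ξ =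
      ‖szegoKernel a ξ‖ ^ 2 • (blaschke a ξ : ℂ) ^ (-(j - k)) := by
  rw [takenaka_apply, takenaka_apply, map_mul, map_zpow₀, ← Circle.coe_inv_eq_conj,
    Circle.coe_inv, inv_zpow', Complex.real_smul, Complex.ofReal_pow, ← Complex.conj_mul',
    neg_sub, zpow_sub₀ (Circle.coe_ne_zero _), zpow_neg]
  ring

theorem conj_takenaka (k : ℤ) (ξ : Circle) :
    conj (takenaka a k ξ) = ξ * takenaka a (-k - 1) ξ := by
  have hb := Circle.coe_ne_zero (blaschke a ξ)
  have hszego : conj (szegoKernel a ξ) = ξ * szegoKernel a ξ / blaschke a ξ := by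
    have h := one_sub_conj_mul_ne_zero a ξ.norm_coe.le
    have hconj : (1 - a * conj (ξ : ℂ)) * ξ = ξ - a := by
      rw [sub_mul, mul_assoc, Complex.conj_mul']
      simp [Circle.norm_coe]
    have hne : 1 - a * conj (ξ : ℂ) ≠ 0 := by
      simpa using (map_ne_zero (starRingEnd ℂ)).mpr h
    rw [eq_div_iff hb, coe_blaschke, szegoKernel, ← hconj]
    simp only [map_div₀, map_sub, map_mul, map_one, Complex.conj_conj, Complex.conj_ofReal]
    field_simp
  rw [takenaka_apply, takenaka_apply, map_mul, map_zpow₀, ← Circle.coe_inv_eq_conj,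
    Circle.coe_inv, inv_zpow', hszego, zpow_sub_one₀ hb]
  ring

theorem integral_conj_takenaka_mul (g : Circle → ℂ) (j k : ℤ) :
    ∫ ξ, conj (takenaka a j ξ) * (g ξ * takenaka a k ξ) ∂circleMeasure =
      circleCoeff (fun ξ => g (blaschke (-a) ξ)) (j - k) := by
  have h := integral_comp_blaschke_neg a fun ξ => (blaschke a ξ : ℂ) ^ (-(j - k)) * g ξ
  have hinv (ξ : Circle) : blaschke a (blaschke (-a) ξ) = ξ :=
    (blaschkeHomeomorph a).apply_symm_apply ξ
  simp only [hinv] at h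
  rw [circleCoeff, h]
  refine integral_congr_ae (ae_of_all _ fun ξ => ?_)
  beta_reduce
  rw [mul_left_comm, conj_takenaka_mul_takenaka, mul_comm, smul_mul_assoc]

theorem orthonormal_takenaka :
    Orthonormal ℂ fun k => (takenaka a k).toLp 2 circleMeasure ℂ := by
  rw [orthonormal_iff_ite]
  intro j k
  have h := integral_conj_takenaka_mul a (fun _ => 1) j k
  simpa [ContinuousMap.inner_toLp, circleCoeff_one, sub_eq_zero, mul_comm] using h

/-- The Hilbert basis of `L²` formed by the Takenaka–Malmquist functions. -/
def takenakaBasis : HilbertBasis ℤ ℂ L2 :=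
  HilbertBasis.mk (orthonormal_takenaka a) <| le_of_eq <| Eq.symm <|
    Submodule.dense_iff_topologicalClosure_eq_top.mp <|
      dense_span_toLp (dense_span_mul_comp dense_span_monomial _ (szegoKernel_ne_zero a))
        ENNReal.ofNat_ne_top

theorem takenakaBasis_apply (k : ℤ) :
    takenakaBasis a k = (takenaka a k).toLp 2 circleMeasure ℂ := by
  rw [takenakaBasis, HilbertBasis.coe_mk]

theorem coeFn_takenakaBasis (k : ℤ) :
    takenakaBasis a k =ᵐ[circleMeasure] takenaka a k := by
  rw [takenakaBasis_apply]
  exact ContinuousMap.coeFn_toLp circleMeasure _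

theorem inner_takenakaBasis (k : ℤ) (f : L2) :
    inner ℂ (takenakaBasis a k) f = ∫ ξ, conj (takenaka a k ξ) * f ξ ∂circleMeasure := by
  rw [takenakaBasis_apply, inner_toLp_left]

end Takenaka

section Hardy

open scoped ComplexConjugate

theorem inner_eq_zero_of_forall_inner_eq_zero_or {ι 𝕜 E : Type*} [RCLike 𝕜]
    [NormedAddCommGroup E] [InnerProductSpace 𝕜 E] (b : HilbertBasis ι 𝕜 E) {x y : E}
    (h : ∀ i, inner 𝕜 x (b i) = 0 ∨ inner 𝕜 (b i) y = 0) : inner 𝕜 x y = 0 := by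
  rw [← b.tsum_inner_mul_inner x y]
  simp only [mul_eq_zero.mpr (h _), tsum_zero]

theorem integral_pow_succ_mul_takenaka (a : 𝔻) (m k : ℕ) :
    ∫ ξ : Circle, (ξ : ℂ) ^ (m + 1) * takenaka a k ξ ∂circleMeasure = 0 := by
  have hz : DiffContOnCl ℂ (fun z : ℂ => z ^ (m + 1)) (Metric.ball 0 1) :=
    (by fun_prop : Differentiable ℂ _).diffContOnCl
  simpa [takenaka_apply, coe_blaschke] using
    integral_circleMeasure_of_diffContOnCl
      (hz.smul ((diffContOnCl_szegoKernel a).smul (diffContOnCl_blaschke_pow a k)))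

theorem inner_monomialBasis_takenakaBasis (a : 𝔻) {m k : ℤ} (hm : m < 0) (hk : 0 ≤ k) :
    inner ℂ (monomialBasis m) (takenakaBasis a k) = 0 := by
  obtain ⟨l, hl⟩ := Int.eq_succ_of_zero_lt (neg_pos.mpr hm)
  lift k to ℕ using hk
  rw [inner_monomialBasis, circleCoeff_congr_ae (coeFn_takenakaBasis a k), circleCoeff, hl]
  exact_mod_cast integral_pow_succ_mul_takenaka a l k

theorem inner_takenakaBasis_monomialBasis (a : 𝔻) {k m : ℤ} (hk : k < 0) (hm : 0 ≤ m) :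
    inner ℂ (takenakaBasis a k) (monomialBasis m) = 0 := by
  obtain ⟨l, hl⟩ := Int.eq_succ_of_zero_lt (neg_pos.mpr hk)
  lift m to ℕ using hm
  rw [inner_takenakaBasis, ← integral_pow_succ_mul_takenaka a m l]
  have hcoe := ContinuousMap.coeFn_toLp (p := 2) (𝕜 := ℂ) circleMeasure (monomial m)
  refine integral_congr_ae (hcoe.mono fun ξ hξ => ?_)
  beta_reduce
  rw [monomialBasis, HilbertBasis.coe_mk, hξ, conj_takenaka, hl]
  simp [monomial]
  ring

theorem mem_hardy_iff (a : 𝔻) {f : L2} :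
    f ∈ hardy ↔ ∀ k : ℤ, k < 0 → inner ℂ (takenakaBasis a k) f = 0 := by
  refine ⟨fun hf k hk => ?_, fun hf m hm => ?_⟩
  · refine inner_eq_zero_of_forall_inner_eq_zero_or monomialBasis fun m => ?_
    rcases lt_or_ge m 0 with hm | hm
    · exact Or.inr ((inner_monomialBasis m f).trans (hf m hm))
    · exact Or.inl (inner_takenakaBasis_monomialBasis a hk hm)
  · rw [← inner_monomialBasis]
    refine inner_eq_zero_of_forall_inner_eq_zero_or (takenakaBasis a) fun k => ?_
    rcases lt_or_ge k 0 with hk | hk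
    · exact Or.inr (hf k hk)
    · exact Or.inl (inner_monomialBasis_takenakaBasis a hm hk)

theorem takenakaBasis_mem_hardy (a : 𝔻) {k : ℤ} (hk : 0 ≤ k) : takenakaBasis a k ∈ hardy :=
  (mem_hardy_iff a).mpr fun _ hj => (takenakaBasis a).orthonormal.2 (hj.trans_le hk).ne

theorem takenakaBasis_mem_hardyInf (a : 𝔻) {k : ℤ} (hk : 0 ≤ k) :
    takenakaBasis a k ∈ hardyInf :=
  ⟨takenakaBasis_mem_hardy a hk, ((takenaka a k).continuous.memLp_of_hasCompactSupport
    (HasCompactSupport.of_compactSpace _)).ae_eq (coeFn_takenakaBasis a k).symm⟩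

theorem takenaka_eq_pow_mul (a : 𝔻) (n : ℕ) (k : ℤ) (ξ : Circle) :
    takenaka a k ξ = ((blaschke a ^ n) ξ : ℂ) * takenaka a (k - n) ξ := by
  have hb := Circle.coe_ne_zero (blaschke a ξ)
  rw [takenaka_apply, takenaka_apply, Pi.pow_apply, Circle.coe_pow, zpow_sub₀ hb, zpow_natCast]
  field_simp

theorem inner_takenakaBasis_of_ae_eq_mul (a : 𝔻) {n : ℕ} (k : ℤ) {f h : L2}
    (hf : ∀ᵐ ξ ∂circleMeasure, f ξ = ((blaschke a ^ n) ξ : ℂ) * h ξ) :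
    inner ℂ (takenakaBasis a k) f = inner ℂ (takenakaBasis a (k - n)) h := by
  rw [inner_takenakaBasis, inner_takenakaBasis]
  refine integral_congr_ae (hf.mono fun ξ hξ => ?_)
  have hunit : conj ((blaschke a ^ n) ξ : ℂ) * (blaschke a ^ n) ξ = 1 := by
    rw [Complex.conj_mul', Circle.norm_coe, Complex.ofReal_one, one_pow]
  beta_reduce
  rw [hξ, takenaka_eq_pow_mul a n k, map_mul]
  linear_combination conj (takenaka a (k - n) ξ) * h ξ * hunit

theorem takenakaBasis_mem_mulHardy (a : 𝔻) {n : ℕ} {k : ℤ} (hk : n ≤ k) :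
    takenakaBasis a k ∈ mulHardy (blaschke a ^ n) := by
  refine ⟨takenakaBasis a (k - n), takenakaBasis_mem_hardy a (sub_nonneg.mpr hk), ?_⟩
  filter_upwards [coeFn_takenakaBasis a k, coeFn_takenakaBasis a (k - n)] with ξ hξ hξ'
  rw [hξ, hξ', takenaka_eq_pow_mul]

theorem mem_modelSpace_iff (a : 𝔻) {n : ℕ} {f : L2} :
    f ∈ modelSpace (blaschke a ^ n) ↔
      ∀ k : ℤ, k ∉ Set.Ico 0 (n : ℤ) → inner ℂ (takenakaBasis a k) f = 0 := by
  refine ⟨fun hf k hk => ?_, fun hf => ⟨(mem_hardy_iff a).mpr fun k hk =>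
    hf k fun h => hk.not_ge h.1, ?_⟩⟩
  · rcases lt_or_ge k 0 with hneg | hneg
    · exact (mem_hardy_iff a).mp hf.1 k hneg
    · exact (Submodule.mem_orthogonal _ f).mp hf.2 _
        (takenakaBasis_mem_mulHardy a (le_of_not_gt fun h => hk ⟨hneg, h⟩))
  · rintro g ⟨h, hh, hg⟩
    refine inner_eq_zero_of_forall_inner_eq_zero_or (takenakaBasis a) fun k => ?_
    rw [inner_eq_zero_symm, inner_takenakaBasis_of_ae_eq_mul a k hg]
    rcases lt_or_ge k n with hk | hk
    · exact Or.inl ((mem_hardy_iff a).mp hh _ (sub_neg.mpr hk))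
    · exact Or.inr (hf k fun h => h.2.not_ge hk)

end Hardy

section ModelSpace

variable (a : 𝔻) (n : ℕ)

theorem takenakaBasis_mem_modelSpace (k : Fin n) :
    takenakaBasis a k ∈ modelSpace (blaschke a ^ n) :=
  (mem_modelSpace_iff a).mpr fun _ hj => (takenakaBasis a).orthonormal.2 fun h =>
    hj (h ▸ ⟨Int.natCast_nonneg k, Int.ofNat_lt.mpr k.2⟩)

theorem orthonormal_takenakaBasis_modelSpace :
    Orthonormal ℂ fun k : Fin n =>
      (⟨takenakaBasis a k, takenakaBasis_mem_modelSpace a n k⟩ : modelSpace (blaschke a ^ n)) := by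
  have h := (takenakaBasis a).orthonormal.comp (fun k : Fin n => (k : ℤ))
    (Nat.cast_injective.comp Fin.val_injective)
  exact ⟨h.1, fun j k hjk => h.2 hjk⟩

theorem orthogonal_span_takenakaBasis_modelSpace :
    (Submodule.span ℂ (Set.range fun k : Fin n => (⟨takenakaBasis a k,
      takenakaBasis_mem_modelSpace a n k⟩ : modelSpace (blaschke a ^ n))))ᗮ = ⊥ := by
  refine (Submodule.eq_bot_iff _).mpr fun f hf => ?_
  rw [← inner_self_eq_zero (𝕜 := ℂ)]
  refine inner_eq_zero_of_forall_inner_eq_zero_or (takenakaBasis a) fun k => Or.inr ?_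
  by_cases hk : k ∈ Set.Ico 0 (n : ℤ)
  · lift k to ℕ using hk.1
    exact hf _ (Submodule.subset_span ⟨⟨k, by exact_mod_cast hk.2⟩, rfl⟩)
  · exact (mem_modelSpace_iff a).mp f.2 k hk

/-- The orthonormal basis of the model space of `b_a ^ n` formed by the Takenaka–Malmquist
functions. -/
def modelSpaceBasis : OrthonormalBasis (Fin n) ℂ (modelSpace (blaschke a ^ n)) :=
  OrthonormalBasis.mkOfOrthogonalEqBot (orthonormal_takenakaBasis_modelSpace a n)
    (orthogonal_span_takenakaBasis_modelSpace a n)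

theorem coe_modelSpaceBasis (k : Fin n) : (modelSpaceBasis a n k : L2) = takenakaBasis a k := by
  rw [modelSpaceBasis, OrthonormalBasis.coe_of_orthogonal_eq_bot_mk]

instance finiteDimensional_modelSpace : FiniteDimensional ℂ (modelSpace (blaschke a ^ n)) :=
  (modelSpaceBasis a n).toBasis.finiteDimensional_of_finite

theorem finrank_modelSpace : Module.finrank ℂ (modelSpace (blaschke a ^ n)) = n := by
  rw [Module.finrank_eq_card_basis (modelSpaceBasis a n).toBasis, Fintype.card_fin]

theorem modelSpace_le_hardyInf : modelSpace (blaschke a ^ n) ≤ hardyInf := fun f hf => by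
  have h := congrArg Subtype.val ((modelSpaceBasis a n).sum_repr ⟨f, hf⟩)
  rw [← show _ = f from h, AddSubmonoidClass.coe_finsetSum]
  refine Submodule.sum_mem _ fun k _ => hardyInf.smul_mem _ ?_
  rw [coe_modelSpaceBasis]
  exact takenakaBasis_mem_hardyInf a (Int.natCast_nonneg k)

end ModelSpace

section Compression

open scoped ComplexConjugate

theorem inner_compression (φ : L2) (θ : Circle → Circle) (hθ : modelSpace θ ≤ hardyInf)
    (u v : modelSpace θ) :
    inner ℂ u (compression φ θ hθ v) =
      ∫ ξ, conj ((u : L2) ξ) * (φ ξ * (v : L2) ξ) ∂circleMeasure := by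
  have hw := memLp_mul φ (Submodule.inclusion hθ v)
  have h : inner ℂ u (compression φ θ hθ v) = inner ℂ (u : L2) hw.toLp :=
    (Submodule.inner_orthogonalProjectionOnto_eq_of_mem_left u _).trans
      (Submodule.inner_orthogonalProjectionOnto_eq_of_mem_left
        (⟨(u : L2), u.2.1⟩ : hardy) _)
  rw [h, L2.inner_def]
  refine integral_congr_ae (hw.coeFn_toLp.mono fun ξ hξ => ?_)
  beta_reduce
  rw [hξ, RCLike.inner_apply']
  rfl

theorem isSymmetric_compression {φ : L2} (hφ : ∀ᵐ ξ ∂circleMeasure, conj (φ ξ) = φ ξ)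
    (θ : Circle → Circle) (hθ : modelSpace θ ≤ hardyInf) :
    (compression φ θ hθ).IsSymmetric := fun u v => by
  rw [← inner_conj_symm, inner_compression, inner_compression, ← integral_conj]
  refine integral_congr_ae (hφ.mono fun ξ hξ => ?_)
  simp only [map_mul, Complex.conj_conj, hξ]
  ring

theorem toMatrix_compression (φ : L2) (a : 𝔻) (n : ℕ)
    (hB : modelSpace (blaschke a ^ n) ≤ hardyInf) :
    (compression φ (blaschke a ^ n) hB).toMatrix (modelSpaceBasis a n).toBasis
        (modelSpaceBasis a n).toBasis =
      toeplitzMatrix (fun ξ => φ (blaschke (-a) ξ)) n := by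
  ext j k
  rw [LinearMap.toMatrix_apply, OrthonormalBasis.coe_toBasis_repr_apply,
    OrthonormalBasis.repr_apply_apply, OrthonormalBasis.coe_toBasis, inner_compression,
    coe_modelSpaceBasis, coe_modelSpaceBasis, toeplitzMatrix, Matrix.of_apply,
    ← integral_conj_takenaka_mul a φ]
  refine integral_congr_ae ?_
  filter_upwards [coeFn_takenakaBasis a j, coeFn_takenakaBasis a k] with ξ hj hk
  rw [hj, hk]

theorem charpoly_compression (φ : L2) (a : 𝔻) (n : ℕ)
    (hB : modelSpace (blaschke a ^ n) ≤ hardyInf) :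
    (compression φ (blaschke a ^ n) hB).charpoly =
      (toeplitzMatrix (fun ξ => φ (blaschke (-a) ξ)) n).charpoly := by
  rw [← toMatrix_compression φ a n hB, LinearMap.charpoly_toMatrix]

end Compression

section Distribution

open scoped ComplexConjugate

theorem IsDistributedEigenvalues.isDistributedSingularValues {φ : L2} {g : Circle → ℂ}
    {B : Circle → Circle} (h : IsDistributedEigenvalues φ g B)
    (hφ : ∀ᵐ ξ ∂circleMeasure, conj (φ ξ) = φ ξ) :
    IsDistributedSingularValues φ (fun ξ => ‖g ξ‖) B := by
  obtain ⟨hg, hfd, hB, h⟩ := h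
  refine ⟨hg.norm, hfd, hB, fun G hG hGc => ?_⟩
  have hGn : HasCompactSupport fun z : ℂ => G ‖z‖ := by
    obtain ⟨R, hR⟩ := hGc.isCompact.isBounded.subset_closedBall 0
    exact HasCompactSupport.intro (isCompact_closedBall 0 R) fun z hz =>
      image_eq_zero_of_notMem_tsupport fun h => hz (by simpa using hR h)
  refine (h _ (hG.comp continuous_norm) hGn).congr fun n => ?_
  have := hfd n
  have hsv := congrArg (fun s => (s.map G).sum)
    (map_singularValues_eq_map_norm_roots_charpoly (isSymmetric_compression hφ (B ^ n) (hB n)))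
  simp only [Multiset.map_map] at hsv
  exact congrArg _ hsv.symm

theorem isDistributedEigenvalues_blaschke (a : 𝔻) {f : Circle → ℝ}
    (hf : MemLp (fun ξ => (f ξ : ℂ)) 2 circleMeasure) :
    IsDistributedEigenvalues hf.toLp (fun ξ => (f (blaschke (-a) ξ) : ℂ)) (blaschke a) := by
  have hfb : MemLp (fun ξ => f (blaschke (-a) ξ)) 2 circleMeasure :=
    memLp_comp_blaschke_neg a hf.re
  refine ⟨hfb.ofReal.1.aemeasurable, finiteDimensional_modelSpace a, modelSpace_le_hardyInf a,
    fun G hG hGc => ?_⟩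
  have hsymbol := comp_blaschke_neg_ae_eq hf.coeFn_toLp a
  simp only [finrank_modelSpace, charpoly_compression, toeplitzMatrix_congr_ae hsymbol]
  exact tendsto_mean_roots_charpoly_toeplitzMatrix hfb hG hGc

end Distribution

end ModelSpaces

end

theorem theorem14 (a : Complex.UnitDisc) (f : Circle → ℝ)
    (hf : MemLp (fun ξ => (f ξ : ℂ)) 2 ModelSpaces.circleMeasure) :
    ModelSpaces.IsDistributedEigenvalues (hf.toLp (fun ξ => (f ξ : ℂ)))
        (fun ξ => (f (ModelSpaces.blaschke (-a) ξ) : ℂ)) (ModelSpaces.blaschke a) ∧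
      ModelSpaces.IsDistributedSingularValues (hf.toLp (fun ξ => (f ξ : ℂ)))
        (fun ξ => |f (ModelSpaces.blaschke (-a) ξ)|) (ModelSpaces.blaschke a) := by
  have heig := ModelSpaces.isDistributedEigenvalues_blaschke a hf
  have hreal : ∀ᵐ ξ ∂ModelSpaces.circleMeasure, starRingEnd ℂ (hf.toLp _ ξ) = hf.toLp _ ξ :=
    hf.coeFn_toLp.mono fun ξ hξ => by rw [hξ, Complex.conj_ofReal]
  refine ⟨heig, ?_⟩
  simpa only [Complex.norm_real, Real.norm_eq_abs] using heig.isDistributedSingularValues hreal
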